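/- Let $(R,\mathfrak m,k)$ be a commutative Noetherian local ring with $\mathfrak m^4=0$ and $\mathfrak m^3\neq 0$. Let $M$ and $N$ be finitely generated $R$-modules such that $\operatorname{Ext}_R^i(M,R)=0=\operatorname{Ext}_R^i(N,R)$ for all $i\gg 0$. Suppose that the minimal free resolutions $F$ of $M$ and $G$ of $N$ are eventually linear. Here, for a minimal free resolution $F=(F_i,\partial_i)$, let $\operatorname{gr}_{\mathfrak m}(F)$ be the complex with $i$-th term $\bigoplus_{p\ge 0}\mathfrak m^pF_i/\mathfrak m^{p+1}F_i$ and differentials $\mathfrak m^pF_i/\mathfrak m^{p+1}F_i\to\mathfrak m^{p+1}F_{i-1}/\mathfrak m^{p+2}F_{i-1}$ induced by $\partial_i$; then $F$ is called eventually linear if $H_i(\operatorname{gr}_{\mathfrak m}(F))=0$ for all $i\gg 0$. Let $b_i(M)=\operatorname{rank}F_i=\dim_k\operatorname{Tor}^R_i(M,k)$ be the Betti numbers of $M$, and similarly for $N$. For a real number $a>1$, a sequence $\{b_i\}_{i\ge 0}$ is said to have exponential growth of base $a$ if there are a real number $\beta>0$ and a sequence $\{\rho_i\}$ of real numbers with $\rho_i/a^i\to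 0$ such that $\beta a^i-\rho_i\le b_i\le\beta a^i+\rho_i$ for all $i\gg 0$. If the Betti sequences of $M$ and $N$ have exponential growth of bases $a$ and $b$, respectively, then $a=b$. -/

import Mathlib

universe u

open Filter Topology

/-- A minimal free resolution `⋯ → R^{b₂} → R^{b₁} → R^{b₀} → M → 0` of a (finitely generated)
module `M` over a local ring `R`: an exact complex of finite free modules in which the image of
each differential lies in `𝔪` times the target.  The rank of the `i`-th free module is the
`i`-th Betti number of `M`, so `betti` is the Betti sequence of `M`. -/
structure MinimalFreeResolution (R : Type u) [CommRing R] [IsLocalRing R]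
    (M : Type u) [AddCommGroup M] [Module R M] where
  betti : ℕ → ℕ
  d : ∀ i : ℕ, (Fin (betti (i + 1)) → R) →ₗ[R] (Fin (betti i) → R)
  aug : (Fin (betti 0) → R) →ₗ[R] M
  aug_surjective : Function.Surjective aug
  exact_zero : Function.Exact (d 0) aug
  exact_succ : ∀ i : ℕ, Function.Exact (d (i + 1)) (d i)
  minimal : ∀ i : ℕ, LinearMap.range (d i) ≤
    IsLocalRing.maximalIdeal R • (⊤ : Submodule R (Fin (betti i) → R))

namespace MinimalFreeResolution

variable {R : Type u} [CommRing R] [IsLocalRing R] {M : Type u} [AddCommGroup M] [Module R M]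

/-- The submodule `𝔪^p F_i` of the `i`-th free module `F_i`. -/
def filt (F : MinimalFreeResolution R M) (p i : ℕ) : Submodule R (Fin (F.betti i) → R) :=
  IsLocalRing.maximalIdeal R ^ p • ⊤

/-- The graded piece `𝔪^p F_i / 𝔪^(p+1) F_i`. -/
abbrev GrPiece (F : MinimalFreeResolution R M) (p i : ℕ) : Type u :=
  ↥(F.filt p i) ⧸ (F.filt (p + 1) i).submoduleOf (F.filt p i)

theorem d_mem_filt (F : MinimalFreeResolution R M) (p i : ℕ)
    (x : Fin (F.betti (i + 1)) → R) (hx : x ∈ F.filt p (i + 1)) :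
    F.d i x ∈ F.filt (p + 1) i := by
  have h1 : F.d i x ∈ (F.filt p (i + 1)).map (F.d i) := Submodule.mem_map_of_mem hx
  have h2 : (F.filt p (i + 1)).map (F.d i) ≤ F.filt (p + 1) i := by
    unfold filt
    rw [Submodule.map_smul'', Submodule.map_top, pow_succ, Submodule.mul_smul]
    exact Submodule.smul_mono le_rfl (F.minimal i)
  exact h2 h1

/-- The restriction `𝔪^p F_{i+1} → 𝔪^(p+1) F_i` of the differential. -/
def dRestrict (F : MinimalFreeResolution R M) (p i : ℕ) :
    ↥(F.filt p (i + 1)) →ₗ[R] ↥(F.filt (p + 1) i) :=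
  (F.d i).restrict (F.d_mem_filt p i)

/-- The differential `𝔪^p F_{i+1} / 𝔪^(p+1) F_{i+1} → 𝔪^(p+1) F_i / 𝔪^(p+2) F_i` of the
associated graded complex `gr_𝔪(F)`. -/
def grDiff (F : MinimalFreeResolution R M) (p i : ℕ) :
    F.GrPiece p (i + 1) →ₗ[R] F.GrPiece (p + 1) i :=
  Submodule.mapQ _ _ (F.dRestrict p i) (fun x hx => F.d_mem_filt (p + 1) i x.1 hx)

/-- `H_{i+1}(gr_𝔪(F)) = 0`.  The degree `i+1` part of `gr_𝔪(F)` is the direct sum over `p ≥ 0` of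
the pieces `𝔪^p F_{i+1} / 𝔪^(p+1) F_{i+1}`.  The piece with `p = 0` receives the zero map (the
piece of index `-1` is zero), so exactness there is injectivity of the outgoing differential. -/
def GrExactAtSucc (F : MinimalFreeResolution R M) (i : ℕ) : Prop :=
  Function.Injective (F.grDiff 0 i) ∧
    ∀ p : ℕ, Function.Exact (F.grDiff p (i + 1)) (F.grDiff (p + 1) i)

/-- The resolution is eventually linear: `H_i(gr_𝔪(F)) = 0` for all large `i`, that is, the
linearity defect of the module is finite. -/
def IsEventuallyLinear (F : MinimalFreeResolution R M) : Prop :=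
  ∃ n : ℕ, ∀ i : ℕ, n ≤ i → F.GrExactAtSucc i

end MinimalFreeResolution

/-- The sequence `s` has exponential growth of base `a`. -/
def HasExponentialGrowth (s : ℕ → ℕ) (a : ℝ) : Prop :=
  1 < a ∧ ∃ β : ℝ, 0 < β ∧ ∃ ρ : ℕ → ℝ,
    Tendsto (fun i => ρ i / a ^ i) atTop (𝓝 0) ∧
    ∀ᶠ i in atTop, β * a ^ i - ρ i ≤ (s i : ℝ) ∧ (s i : ℝ) ≤ β * a ^ i + ρ i

/-- `Ext^i_R(M, R) = 0` for all large `i`. -/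
def ExtEventuallyVanishes (R : Type u) [CommRing R] (M : Type u) [AddCommGroup M] [Module R M] :
    Prop :=
  ∃ n : ℕ, ∀ i : ℕ, n ≤ i →
    Subsingleton (CategoryTheory.Abelian.Ext (ModuleCat.of R M) (ModuleCat.of R R) i)

/-!
Suppose that `a < b`, let `eₚ = dim_k 𝔪ᵖ/𝔪ᵖ⁺¹` be the Hilbert function of `R` and let `s` be the
dimension of its socle. The contradiction comes from comparing two facts about `a` and `b`.

*Linearity.* As `𝔪⁴ = 0`, eventual linearity says that the strands
`0 → F_{i+3}/𝔪 → 𝔪F_{i+2}/𝔪² → 𝔪²F_{i+1}/𝔪³ → 𝔪³F_i → 0` of the associated graded complexes are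
exact for large `i`. Counting lengths shows that the Betti numbers of `M` and of `N` eventually
satisfy one and the same linear recurrence, so `a` and `b` are both roots of
`t³ - e₁t² + e₂t - e₃` (`eventually_betti_recurrence`, `HasExponentialGrowth.isRoot`).

*Vanishing of Ext.* As `Ext^i(M, R)` and `Ext^i(N, R)` vanish for large `i`, the complexes
`Hom(F, R)` and `Hom(G, R)` are eventually exact. Let `C_m` be the kernel of
`Hom(F_m, R) → Hom(F_{m+1}, R)`. Then `Ext^{j+1}(N, C_m)` only depends on `j + m`, so its length
is at most a constant times `b_{m+j}(M)`, which for fixed `m` is of the order of `a^j` and hence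
negligible against `b_j(N)`. On the other hand, minimality of `F` puts the socle of `Hom(F_m, R)`,
a vector space of dimension `s · b_m(M)`, inside `C_m`. By minimality of `G`, its cohomology with
respect to `N` is as large as possible, and what does not survive in `Ext^{j+1}(N, C_m)` is hit by
a connecting map from a module of length at most `b_j(N) (length C_m - s · b_m(M))`. Letting
`j → ∞` gives `(1 + b) · s · b_m(M) ≤ length C_m`. Since
`length C_m + length C_{m+1} = b_m(M) · length R`, letting `m → ∞` yields
`(1 + a) (1 + b) s ≤ length R` (`mul_socleDim_le_natLength`).

*Conclusion.* Let `c` be the third root, so that `abc = e₃`. Since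
`length R = 1 + e₁ + e₂ + e₃ = (1 + a) (1 + b) (1 + c)`, this says `s ≤ 1 + c`. As `𝔪³` lies in the
socle, `abc = e₃ ≤ s ≤ 1 + c`, and integrality of the `eₚ` leaves only the case `e₃ = s = 1`, where
`c < 1`. There `R` is Gorenstein, multiplication embeds `𝔪²/𝔪³` into `Hom(𝔪/𝔪², 𝔪³)`, and so
`e₂ ≤ e₁`; but the characteristic polynomial takes the value
`(1 - a) (1 - b) (1 - c) = 1 - e₁ + e₂ - e₃ = e₂ - e₁ > 0` at `1`
(`hilbertFun_two_le`, `not_lt_of_characteristic_roots`).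
-/

/-! ### Vanishing of Ext and exactness of the dual complex -/

open CategoryTheory Abelian in
/-- Dimension shifting along `0 → ker f → P → X → 0` with `P` projective. -/
theorem subsingleton_ext_ker {R P X : Type u} [CommRing R] [AddCommGroup P] [Module R P]
    [Module.Projective R P] [AddCommGroup X] [Module R X] (Y : ModuleCat.{u} R)
    (f : P →ₗ[R] X) (hf : Function.Surjective f) {K : Submodule R P} (hK : LinearMap.ker f = K)
    (n : ℕ) (h : Subsingleton (Ext (ModuleCat.of R X) Y (n + 2))) :
    Subsingleton (Ext (ModuleCat.of R K) Y (n + 1)) := by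
  subst hK
  have hS := LinearMap.shortExact_shortComplexKer hf
  have : Projective (ModuleCat.of R P) := (IsProjective.iff_projective (R := R) P).mp inferInstance
  refine subsingleton_of_forall_eq 0 fun x => ?_
  obtain ⟨y, hy⟩ := Ext.contravariant_sequence_exact₁ hS Y x (n₁ := n + 2) (by lia)
    (Subsingleton.elim (α := Ext (ModuleCat.of R X) Y (n + 2)) _ _)
  rw [← hy, Ext.eq_zero_of_projective (P := ModuleCat.of R P) y, Ext.comp_zero]

open CategoryTheory Abelian in
/-- If `Ext¹(X, Y) = 0` then homomorphisms into `Y` extend from the kernel of a surjection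
`P → X` to `P`. -/
theorem exists_extend_of_subsingleton_ext_one {R P X Y : Type u} [CommRing R] [AddCommGroup P]
    [Module R P] [AddCommGroup X] [Module R X] [AddCommGroup Y] [Module R Y]
    (f : P →ₗ[R] X) (hf : Function.Surjective f) {K : Submodule R P} (hK : LinearMap.ker f = K)
    (h : Subsingleton (Ext (ModuleCat.of R X) (ModuleCat.of R Y) 1)) (φ : K →ₗ[R] Y) :
    ∃ ψ : P →ₗ[R] Y, ψ ∘ₗ K.subtype = φ := by
  subst hK
  have hS := LinearMap.shortExact_shortComplexKer hf
  obtain ⟨y, hy⟩ := Ext.contravariant_sequence_exact₁ hS (ModuleCat.of R Y)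
    (Ext.mk₀ (ModuleCat.ofHom φ)) (n₁ := 1) (by lia)
    (Subsingleton.elim (α := Ext (ModuleCat.of R X) (ModuleCat.of R Y) 1) _ _)
  obtain ⟨g, rfl⟩ := Ext.mk₀_bijective _ _ |>.2 y
  rw [Ext.mk₀_comp_mk₀] at hy
  refine ⟨g.hom, ?_⟩
  have := congrArg ModuleCat.Hom.hom ((Ext.mk₀_bijective _ _).1 hy)
  simpa using this

namespace MinimalFreeResolution

variable {R : Type u} [CommRing R] [IsLocalRing R] {M : Type u} [AddCommGroup M] [Module R M]

/-- `Ext^{n+1}` of the `(i+1)`-st syzygy is `Ext^{n+i+2}` of the module. -/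
theorem subsingleton_ext_range (F : MinimalFreeResolution R M) (Y : ModuleCat.{u} R) (i : ℕ) :
    ∀ n : ℕ, Subsingleton (CategoryTheory.Abelian.Ext (ModuleCat.of R M) Y (n + i + 2)) →
      Subsingleton (CategoryTheory.Abelian.Ext
        (ModuleCat.of R (LinearMap.range (F.d i))) Y (n + 1)) := by
  induction i with
  | zero =>
    intro n h
    exact subsingleton_ext_ker Y F.aug F.aug_surjective (LinearMap.exact_iff.mp F.exact_zero) n h
  | succ i ih =>
    intro n h
    refine subsingleton_ext_ker Y (F.d i).rangeRestrict (F.d i).surjective_rangeRestrict ?_ n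
      (ih (n + 1) ?_)
    · rw [LinearMap.ker_rangeRestrict]
      exact LinearMap.exact_iff.mp (F.exact_succ i)
    · rwa [show n + 1 + i + 2 = n + (i + 1) + 2 by lia]

/-- The complex `Hom(F, X)` is exact at `Hom(F_{j+1}, X)`. -/
def HomExactAtSucc (F : MinimalFreeResolution R M) (X : Type*) [AddCommGroup X] [Module R X]
    (j : ℕ) : Prop :=
  ∀ f : (Fin (F.betti (j + 1)) → R) →ₗ[R] X, f ∘ₗ F.d (j + 1) = 0 →
    ∃ g : (Fin (F.betti j) → R) →ₗ[R] X, f = g ∘ₗ F.d j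

theorem eventually_homExactAtSucc (F : MinimalFreeResolution R M)
    (hM : ExtEventuallyVanishes R M) : ∃ n : ℕ, ∀ j, n ≤ j → F.HomExactAtSucc R j := by
  obtain ⟨n, hn⟩ := hM
  refine ⟨n + 1, fun j hj f hf => ?_⟩
  obtain ⟨j, rfl⟩ : ∃ k, j = k + 1 := ⟨j - 1, by lia⟩
  -- `f` kills `ker d_j = range d_{j+1}`, so it descends to `φ : range d_j → R`
  have hker : LinearMap.ker (F.d (j + 1)).rangeRestrict ≤ LinearMap.ker f := by
    rw [LinearMap.ker_rangeRestrict, LinearMap.exact_iff.mp (F.exact_succ (j + 1))]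
    rintro _ ⟨x, rfl⟩
    exact LinearMap.congr_fun hf x
  let φ : LinearMap.range (F.d (j + 1)) →ₗ[R] R :=
    ((LinearMap.ker (F.d (j + 1)).rangeRestrict).liftQ f hker) ∘ₗ
      ((F.d (j + 1)).rangeRestrict.quotKerEquivOfSurjective
        (F.d (j + 1)).surjective_rangeRestrict).symm.toLinearMap
  have hφ : ∀ x, φ ((F.d (j + 1)).rangeRestrict x) = f x := by
    intro x
    have : ((F.d (j + 1)).rangeRestrict.quotKerEquivOfSurjective
        (F.d (j + 1)).surjective_rangeRestrict).symm ((F.d (j + 1)).rangeRestrict x) =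
        Submodule.Quotient.mk x := by
      rw [LinearEquiv.symm_apply_eq]; rfl
    simp only [φ, LinearMap.comp_apply, LinearEquiv.coe_coe, this]
    rfl
  obtain ⟨ψ, hψ⟩ := exists_extend_of_subsingleton_ext_one (F.d j).rangeRestrict
    (F.d j).surjective_rangeRestrict
    (by rw [LinearMap.ker_rangeRestrict]; exact LinearMap.exact_iff.mp (F.exact_succ j))
    (F.subsingleton_ext_range _ j 0 (hn _ (by lia))) φ
  refine ⟨ψ, LinearMap.ext fun x => ?_⟩
  rw [← hφ, ← hψ]
  rfl

end MinimalFreeResolution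

/-! ### Lengths -/

/-- The length of a module as a natural number; it is only used for modules of finite length. -/
noncomputable def natLength (R : Type*) (X : Type*) [Ring R] [AddCommGroup X] [Module R X] : ℕ :=
  (Module.length R X).toNat

section natLength

variable {R : Type*} [Ring R] {A B C D : Type*} [AddCommGroup A] [Module R A] [AddCommGroup B]
  [Module R B] [AddCommGroup C] [Module R C] [AddCommGroup D] [Module R D]

theorem coe_natLength (R A : Type*) [Ring R] [AddCommGroup A] [Module R A] [IsNoetherian R A]
    [IsArtinian R A] : (natLength R A : ℕ∞) = Module.length R A :=
  ENat.natCast_toNat Module.length_ne_top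

theorem LinearEquiv.natLength_eq (e : A ≃ₗ[R] B) : natLength R A = natLength R B := by
  rw [natLength, natLength, e.length_eq]

theorem natLength_eq_add_of_exact [IsNoetherian R B] [IsArtinian R B] (f : A →ₗ[R] B)
    (g : B →ₗ[R] C) (hf : Function.Injective f) (hg : Function.Surjective g)
    (h : Function.Exact f g) : natLength R B = natLength R A + natLength R C := by
  have := isNoetherian_of_injective f hf
  have := isArtinian_of_injective f hf
  have := isNoetherian_of_surjective g (LinearMap.range_eq_top.mpr hg)
  have := isArtinian_of_surjective B g hg
  have key := Module.length_eq_add_of_exact f g hf hg h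
  rw [← coe_natLength, ← coe_natLength, ← coe_natLength] at key
  exact_mod_cast key

theorem natLength_le_of_injective [IsNoetherian R B] [IsArtinian R B] (f : A →ₗ[R] B)
    (hf : Function.Injective f) : natLength R A ≤ natLength R B :=
  ENat.toNat_le_toNat (Module.length_le_of_injective f hf) Module.length_ne_top

theorem natLength_le_of_surjective [IsNoetherian R A] [IsArtinian R A] (f : A →ₗ[R] B)
    (hf : Function.Surjective f) : natLength R B ≤ natLength R A :=
  ENat.toNat_le_toNat (Module.length_le_of_surjective f hf) Module.length_ne_top

theorem natLength_eq_zero [Subsingleton A] : natLength R A = 0 := by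
  simp [natLength, Module.length_eq_zero]

theorem natLength_pos [IsNoetherian R A] [IsArtinian R A] [Nontrivial A] : 0 < natLength R A := by
  have h : 0 < Module.length R A := Module.length_pos
  rw [← coe_natLength] at h
  exact_mod_cast h

theorem natLength_pi_fin (n : ℕ) : natLength R (Fin n → A) = n * natLength R A := by
  simp [natLength, ENat.toNat_mul]

theorem natLength_ker_add_range [IsNoetherian R A] [IsArtinian R A] (f : A →ₗ[R] B) :
    natLength R A = natLength R (LinearMap.ker f) + natLength R (LinearMap.range f) :=
  natLength_eq_add_of_exact (LinearMap.ker f).subtype f.rangeRestrict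
    (Submodule.subtype_injective _) f.surjective_rangeRestrict fun x => by
      simp [← LinearMap.mem_ker]

/-- If `ker u ⊆ ker v` with `v` onto, then the target of `v` is a quotient of the range of `u`. -/
theorem natLength_le_of_ker_le [IsNoetherian R A] [IsArtinian R A] [IsNoetherian R B]
    [IsArtinian R B] (u : A →ₗ[R] B) (v : A →ₗ[R] C) (hv : Function.Surjective v)
    (huv : LinearMap.ker u ≤ LinearMap.ker v) : natLength R C ≤ natLength R B := by
  have h1 := natLength_ker_add_range u
  have h2 := natLength_eq_add_of_exact (LinearMap.ker v).subtype v
    (Submodule.subtype_injective _) hv fun x => by simp [← LinearMap.mem_ker]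
  have h3 := natLength_le_of_injective (Submodule.inclusion huv)
    (Submodule.inclusion_injective huv)
  have h4 := natLength_le_of_injective (LinearMap.range u).subtype
    (Submodule.subtype_injective _)
  lia

/-- Lengths in an exact sequence `0 → A → B → C → D → 0`. -/
theorem natLength_add_eq_add_of_exact [IsNoetherian R B] [IsArtinian R B] [IsNoetherian R C]
    [IsArtinian R C] (f : A →ₗ[R] B) (g : B →ₗ[R] C) (h : C →ₗ[R] D)
    (hf : Function.Injective f) (hfg : Function.Exact f g) (hgh : Function.Exact g h)
    (hh : Function.Surjective h) :
    natLength R A + natLength R C = natLength R B + natLength R D := by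
  have h1 := natLength_eq_add_of_exact f g.rangeRestrict hf g.surjective_rangeRestrict
    fun x => by rw [← hfg x]; exact Subtype.ext_iff
  have h2 := natLength_eq_add_of_exact (LinearMap.range g).subtype h
    (Submodule.subtype_injective _) hh fun x => by rw [hgh x]; simp
  lia

theorem natLength_submodule_add_quotient [IsNoetherian R B] [IsArtinian R B]
    (N N' : Submodule R B) (h : N' ≤ N) :
    natLength R N = natLength R N' + natLength R (N ⧸ N'.submoduleOf N) :=
  natLength_eq_add_of_exact (Submodule.inclusion h) (N'.submoduleOf N).mkQ
    (Submodule.inclusion_injective h) (Submodule.mkQ_surjective _) fun x => by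
      simp only [Submodule.mkQ_apply, Submodule.Quotient.mk_eq_zero]
      exact ⟨fun hx => ⟨⟨x, hx⟩, rfl⟩, by rintro ⟨y, rfl⟩; exact y.2⟩

end natLength

theorem Ideal.mem_smul_top_pi_iff {R : Type*} [CommRing R] (I : Ideal R) {n : ℕ}
    (x : Fin n → R) : x ∈ I • (⊤ : Submodule R (Fin n → R)) ↔ ∀ i, x i ∈ I := by
  constructor
  · intro hx i
    have hle : I • (⊤ : Submodule R (Fin n → R)) ≤ Submodule.comap (LinearMap.proj i) I :=
      Submodule.smul_le.mpr fun r hr y _ => by simpa using I.mul_mem_right (y i) hr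
    exact hle hx
  · intro hx
    rw [pi_eq_sum_univ' x]
    exact Submodule.sum_mem _ fun i _ => Submodule.smul_mem_smul (hx i) trivial

theorem Ideal.natLength_smul_top_pi {R : Type*} [CommRing R] (I : Ideal R) (n : ℕ) :
    natLength R (I • (⊤ : Submodule R (Fin n → R)) : Submodule R (Fin n → R)) =
      n * natLength R I := by
  rw [← natLength_pi_fin]
  refine LinearEquiv.natLength_eq (LinearEquiv.ofBijective
    (LinearMap.pi fun i => (LinearMap.proj i).restrict
      fun x hx => (I.mem_smul_top_pi_iff x).mp hx i) ⟨?_, ?_⟩)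
  · intro x y h
    ext i
    exact congrArg Subtype.val (congrFun h i)
  · intro y
    exact ⟨⟨fun i => y i, (I.mem_smul_top_pi_iff _).mpr fun i => (y i).2⟩, rfl⟩

/-! ### The Hilbert function and the recurrence for Betti numbers -/

/-- The value `dim_k 𝔪^p / 𝔪^(p+1)` of the Hilbert function of a local ring. -/
noncomputable def hilbertFun (R : Type*) [CommRing R] [IsLocalRing R] (p : ℕ) : ℕ :=
  natLength R (↥(IsLocalRing.maximalIdeal R ^ p) ⧸
    (IsLocalRing.maximalIdeal R ^ (p + 1)).submoduleOf (IsLocalRing.maximalIdeal R ^ p))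

theorem natLength_pow_maximalIdeal (R : Type*) [CommRing R] [IsLocalRing R] [IsNoetherianRing R]
    [IsArtinianRing R] (p : ℕ) :
    natLength R ↥(IsLocalRing.maximalIdeal R ^ p) =
      natLength R ↥(IsLocalRing.maximalIdeal R ^ (p + 1)) + hilbertFun R p :=
  natLength_submodule_add_quotient _ _ (Ideal.pow_le_pow_right p.le_succ)

namespace MinimalFreeResolution

variable {R : Type u} [CommRing R] [IsLocalRing R] {M : Type u} [AddCommGroup M] [Module R M]

theorem natLength_grPiece [IsNoetherianRing R] [IsArtinianRing R] (F : MinimalFreeResolution R M)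
    (p i : ℕ) : natLength R (F.GrPiece p i) = F.betti i * hilbertFun R p := by
  have h1 := natLength_submodule_add_quotient (F.filt p i) (F.filt (p + 1) i)
    (Submodule.smul_mono_left (Ideal.pow_le_pow_right p.le_succ))
  have h2 : ∀ q, natLength R (F.filt q i) =
      F.betti i * natLength R ↥(IsLocalRing.maximalIdeal R ^ q) :=
    fun q => Ideal.natLength_smul_top_pi _ _
  rw [h2, h2, natLength_pow_maximalIdeal R p, mul_add] at h1
  exact (Nat.add_left_cancel h1).symm

/-- When `𝔪⁴ = 0`, the strands `0 → F_{i+3}/𝔪 → 𝔪F_{i+2}/𝔪² → 𝔪²F_{i+1}/𝔪³ → 𝔪³F_i → 0` of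
`gr_𝔪(F)` are exact for large `i`, which gives a linear recurrence for the Betti numbers. -/
theorem eventually_betti_recurrence [IsNoetherianRing R] [IsArtinianRing R]
    (hm4 : IsLocalRing.maximalIdeal R ^ 4 = ⊥) (F : MinimalFreeResolution R M)
    (hF : F.IsEventuallyLinear) : ∃ n : ℕ, ∀ i, n ≤ i →
      F.betti (i + 3) * hilbertFun R 0 + F.betti (i + 1) * hilbertFun R 2 =
        F.betti (i + 2) * hilbertFun R 1 + F.betti i * hilbertFun R 3 := by
  obtain ⟨n, hn⟩ := hF
  refine ⟨n + 1, fun i hi => ?_⟩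
  obtain ⟨i, rfl⟩ : ∃ k, i = k + 1 := ⟨i - 1, by lia⟩
  simp only [← F.natLength_grPiece]
  have : Subsingleton (F.filt 4 i) := by
    rw [filt, hm4, Submodule.bot_smul]
    infer_instance
  exact natLength_add_eq_add_of_exact (F.grDiff 0 (i + 3)) (F.grDiff 1 (i + 2))
    (F.grDiff 2 (i + 1)) (hn (i + 3) (by lia)).1 ((hn (i + 2) (by lia)).2 0)
    ((hn (i + 1) (by lia)).2 1)
    fun y => ((hn i (by lia)).2 2 y).mp
      ((Submodule.Quotient.mk_surjective _).subsingleton.elim _ _)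

end MinimalFreeResolution

/-! ### Cohomology of `Hom(F, X)` and dimension shifting -/

theorem natLength_linearMap_pi {R X : Type*} [CommRing R] [AddCommGroup X] [Module R X] (n : ℕ) :
    natLength R ((Fin n → R) →ₗ[R] X) = n * natLength R X := by
  rw [← natLength_pi_fin]
  exact (LinearEquiv.piRing R X (Fin n) R).natLength_eq

/-- The dimension of the socle of a local ring. -/
noncomputable def socleDim (R : Type*) [CommRing R] [IsLocalRing R] : ℕ :=
  natLength R (Submodule.torsionBySet R R (IsLocalRing.maximalIdeal R))

namespace MinimalFreeResolution

variable {R : Type u} [CommRing R] [IsLocalRing R] {M : Type u} [AddCommGroup M] [Module R M]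

/-- The differential `Hom(F_j, X) → Hom(F_{j+1}, X)`. -/
def homDiff (F : MinimalFreeResolution R M) (X : Type*) [AddCommGroup X] [Module R X] (j : ℕ) :
    ((Fin (F.betti j) → R) →ₗ[R] X) →ₗ[R] ((Fin (F.betti (j + 1)) → R) →ₗ[R] X) :=
  LinearMap.lcomp R X (F.d j)

/-- The cohomology of `Hom(F, X)` at `Hom(F_{j+1}, X)`, that is, `Ext^{j+1}(M, X)`. -/
abbrev HomCohomology (F : MinimalFreeResolution R M) (X : Type*) [AddCommGroup X] [Module R X]
    (j : ℕ) : Type _ :=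
  LinearMap.ker (F.homDiff X (j + 1)) ⧸
    (LinearMap.range (F.homDiff X j)).submoduleOf (LinearMap.ker (F.homDiff X (j + 1)))

theorem d_comp_d (F : MinimalFreeResolution R M) (j : ℕ) : F.d j ∘ₗ F.d (j + 1) = 0 :=
  (F.exact_succ j).linearMap_comp_eq_zero

theorem range_homDiff_le_ker (F : MinimalFreeResolution R M) (X : Type*) [AddCommGroup X]
    [Module R X] (j : ℕ) :
    LinearMap.range (F.homDiff X j) ≤ LinearMap.ker (F.homDiff X (j + 1)) := by
  rintro _ ⟨g, rfl⟩
  change (g ∘ₗ F.d j) ∘ₗ F.d (j + 1) = 0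
  rw [LinearMap.comp_assoc, d_comp_d, LinearMap.comp_zero]

theorem HomExactAtSucc.dual {F : MinimalFreeResolution R M} {j : ℕ} (h : F.HomExactAtSucc R j)
    (n : ℕ) : F.HomExactAtSucc ((Fin n → R) →ₗ[R] R) j := by
  intro f hf
  have hex : ∀ i : Fin n, ∃ g : (Fin (F.betti j) → R) →ₗ[R] R,
      LinearMap.applyₗ (Pi.single i 1) ∘ₗ f = g ∘ₗ F.d j := fun i =>
    h _ (by rw [LinearMap.comp_assoc, hf, LinearMap.comp_zero])
  choose g hg using hex
  refine ⟨(LinearEquiv.piRing R R (Fin n) R).symm.toLinearMap ∘ₗ LinearMap.pi g,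
    LinearMap.ext fun x => ?_⟩
  rw [LinearMap.comp_apply, LinearMap.comp_apply, LinearEquiv.coe_coe, LinearEquiv.eq_symm_apply]
  exact funext fun i => LinearMap.congr_fun (hg i) x

/-- A homomorphism from `F_j` into a module killed by `𝔪` is a cocycle, as `F` is minimal. -/
theorem comp_d_eq_zero_of_forall_smul_eq_zero (F : MinimalFreeResolution R M) {X : Type*}
    [AddCommGroup X] [Module R X] (j : ℕ) (f : (Fin (F.betti j) → R) →ₗ[R] X)
    (hf : ∀ r ∈ IsLocalRing.maximalIdeal R, ∀ x, r • f x = 0) : f ∘ₗ F.d j = 0 := by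
  have hle : IsLocalRing.maximalIdeal R • (⊤ : Submodule R (Fin (F.betti j) → R)) ≤
      LinearMap.ker f :=
    Submodule.smul_le.mpr fun r hr x _ => by simpa using hf r hr x
  exact LinearMap.ext fun x => hle (F.minimal j ⟨x, rfl⟩)

/-! ### The cocycle modules of the dual complex -/

/-- The term `Hom(F_m, R)` of the dual complex. -/
def DualTerm (F : MinimalFreeResolution R M) (m : ℕ) : Type u :=
  (Fin (F.betti m) → R) →ₗ[R] R

instance (F : MinimalFreeResolution R M) (m : ℕ) : AddCommGroup (F.DualTerm m) :=
  inferInstanceAs (AddCommGroup ((Fin (F.betti m) → R) →ₗ[R] R))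

instance (F : MinimalFreeResolution R M) (m : ℕ) : Module R (F.DualTerm m) :=
  inferInstanceAs (Module R ((Fin (F.betti m) → R) →ₗ[R] R))

instance [IsNoetherianRing R] (F : MinimalFreeResolution R M) (m : ℕ) :
    Module.Finite R (F.DualTerm m) :=
  inferInstanceAs (Module.Finite R ((Fin (F.betti m) → R) →ₗ[R] R))

/-- The differential `Hom(F_m, R) → Hom(F_{m+1}, R)` of the dual complex. -/
def dualD (F : MinimalFreeResolution R M) (m : ℕ) : F.DualTerm m →ₗ[R] F.DualTerm (m + 1) :=
  F.homDiff R m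

theorem natLength_dualTerm (F : MinimalFreeResolution R M) (m : ℕ) :
    natLength R (F.DualTerm m) = F.betti m * natLength R R :=
  natLength_linearMap_pi _

/-- The kernel `C_m` of `Hom(F_m, R) → Hom(F_{m+1}, R)`, that is, the dual of the `m`-th syzygy. -/
abbrev dualKer (F : MinimalFreeResolution R M) (m : ℕ) : Submodule R (F.DualTerm m) :=
  LinearMap.ker (F.dualD m)

/-- The map `Hom(F_m, R) → C_{m+1}`, with kernel `C_m`. -/
def toDualKer (F : MinimalFreeResolution R M) (m : ℕ) :
    F.DualTerm m →ₗ[R] F.dualKer (m + 1) :=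
  (F.dualD m).codRestrict _ fun f => F.range_homDiff_le_ker R m ⟨f, rfl⟩

theorem ker_toDualKer (F : MinimalFreeResolution R M) (m : ℕ) :
    LinearMap.ker (F.toDualKer m) = F.dualKer m :=
  LinearMap.ker_codRestrict _ _ _

theorem toDualKer_surjective {F : MinimalFreeResolution R M} {m : ℕ}
    (h : F.HomExactAtSucc R m) : Function.Surjective (F.toDualKer m) := fun f =>
  (h f.1 f.2).imp fun _ hg => Subtype.ext hg.symm

variable [IsNoetherianRing R] [IsArtinianRing R]

theorem natLength_homCohomology_le (F : MinimalFreeResolution R M) (X : Type*) [AddCommGroup X]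
    [Module R X] [Module.Finite R X] (j : ℕ) :
    natLength R (F.HomCohomology X j) ≤ F.betti (j + 1) * natLength R X := by
  rw [← natLength_linearMap_pi]
  exact (natLength_le_of_surjective _ (Submodule.mkQ_surjective _)).trans
    (natLength_le_of_injective (Submodule.subtype _) (Submodule.subtype_injective _))

/-- Dimension shifting in the second variable: if `0 → ker q → P → C → 0` is exact and
`Ext^{j+2}(M, P) = 0` then the connecting map `Ext^{j+1}(M, C) → Ext^{j+2}(M, ker q)` is
surjective. -/
theorem natLength_homCohomology_ker_le (F : MinimalFreeResolution R M) {P C : Type*}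
    [AddCommGroup P] [Module R P] [Module.Finite R P] [AddCommGroup C] [Module R C]
    [Module.Finite R C] (q : P →ₗ[R] C) (hq : Function.Surjective q) (j : ℕ)
    (hP : F.HomExactAtSucc P (j + 1)) :
    natLength R (F.HomCohomology (LinearMap.ker q) (j + 1)) ≤
      natLength R (F.HomCohomology C j) := by
  -- `Y` consists of the cochains `y` with values in `P` whose image in `C` is a cocycle
  let Y : Submodule R ((Fin (F.betti (j + 1)) → R) →ₗ[R] P) :=
    LinearMap.ker (F.homDiff C (j + 1) ∘ₗ LinearMap.compRight R q)
  have hY : ∀ y : Y, ∀ x, q (y.1 (F.d (j + 1) x)) = 0 := fun y x =>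
    LinearMap.congr_fun (LinearMap.mem_ker.mp y.2) x
  let u : Y →ₗ[R] F.HomCohomology C j := Submodule.mkQ _ ∘ₗ
    (LinearMap.compRight R q ∘ₗ Y.subtype).codRestrict _ fun y => y.2
  let v₀ : Y →ₗ[R] LinearMap.ker (F.homDiff (LinearMap.ker q) (j + 1 + 1)) :=
    { toFun := fun y => ⟨(y.1 ∘ₗ F.d (j + 1)).codRestrict (LinearMap.ker q) (hY y), by
        refine LinearMap.ext fun x => Subtype.ext ?_
        have := LinearMap.congr_fun (F.d_comp_d (j + 1)) x
        change y.1 (F.d (j + 1) (F.d (j + 1 + 1) x)) = 0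
        simpa using congrArg y.1 this⟩
      map_add' := fun _ _ => rfl
      map_smul' := fun _ _ => rfl }
  let v : Y →ₗ[R] F.HomCohomology (LinearMap.ker q) (j + 1) := Submodule.mkQ _ ∘ₗ v₀
  have hv : Function.Surjective v := by
    refine (Submodule.mkQ_surjective _).comp fun z => ?_
    obtain ⟨g, hg⟩ := hP ((LinearMap.ker q).subtype ∘ₗ z.1) (by
      rw [LinearMap.comp_assoc, show z.1 ∘ₗ F.d (j + 1 + 1) = 0 from z.2, LinearMap.comp_zero])
    have hgz : ∀ x, g (F.d (j + 1) x) = z.1 x := fun x => (LinearMap.congr_fun hg x).symm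
    refine ⟨⟨g, ?_⟩, Subtype.ext (LinearMap.ext fun x => Subtype.ext (hgz x))⟩
    refine LinearMap.ext fun x => ?_
    change q (g (F.d (j + 1) x)) = 0
    rw [hgz]
    exact (z.1 x).2
  have huv : LinearMap.ker u ≤ LinearMap.ker v := by
    intro y hy
    obtain ⟨w, hw⟩ : ∃ w, F.homDiff C j w = q ∘ₗ y.1 := by
      have hy' := (Submodule.Quotient.mk_eq_zero _).mp (LinearMap.mem_ker.mp hy)
      exact hy'
    -- lift `w` along `q` and subtract the coboundary of the lift from `y`
    obtain ⟨w', rfl⟩ := Module.projective_lifting_property q w hq |>.imp fun _ h => h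
    have hmem : ∀ x, (y.1 - w' ∘ₗ F.d j) x ∈ LinearMap.ker q := fun x => by
      have := LinearMap.congr_fun hw x
      change q (w' (F.d j x)) = q (y.1 x) at this
      simp [this]
    have : v₀ y ∈ (LinearMap.range (F.homDiff (LinearMap.ker q) (j + 1))).submoduleOf
        (LinearMap.ker (F.homDiff (LinearMap.ker q) (j + 1 + 1))) := by
      refine ⟨(y.1 - w' ∘ₗ F.d j).codRestrict _ hmem, LinearMap.ext fun x => Subtype.ext ?_⟩
      have h0 : F.d j (F.d (j + 1) x) = 0 := LinearMap.congr_fun (F.d_comp_d j) x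
      change y.1 (F.d (j + 1) x) - w' (F.d j (F.d (j + 1) x)) = y.1 (F.d (j + 1) x)
      simp [h0]
    simpa [v] using this
  exact natLength_le_of_ker_le u v hv huv

/-- For `T ⊆ X` killed by `𝔪`, the connecting map `Ext^j(M, X/T) → Ext^{j+1}(M, T)` has image of
length at most `b_j · length(X/T)`, whereas `Ext^{j+1}(M, T)` has length `b_{j+1} · length T`. -/
theorem betti_mul_natLength_torsion_le (F : MinimalFreeResolution R M) (X : Type*)
    [AddCommGroup X] [Module R X] [Module.Finite R X] (j : ℕ) :
    (F.betti (j + 1) + F.betti j) *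
        natLength R (Submodule.torsionBySet R X (IsLocalRing.maximalIdeal R)) ≤
      F.betti j * natLength R X + natLength R (F.HomCohomology X j) := by
  set T := Submodule.torsionBySet R X (IsLocalRing.maximalIdeal R)
  have hT : ∀ i, F.betti i * natLength R T ≤ natLength R (LinearMap.ker (F.homDiff X i)) := by
    intro i
    rw [← natLength_linearMap_pi]
    have hz : ∀ f : (Fin (F.betti i) → R) →ₗ[R] T,
        LinearMap.compRight R T.subtype f ∈ LinearMap.ker (F.homDiff X i) := fun f =>
      F.comp_d_eq_zero_of_forall_smul_eq_zero i (T.subtype ∘ₗ f) fun r hr x =>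
        (Submodule.mem_torsionBySet_iff _ _).mp (f x).2 ⟨r, hr⟩
    refine natLength_le_of_injective ((LinearMap.compRight R T.subtype).codRestrict _ hz)
      fun f g hfg => ?_
    · exact LinearMap.ext fun x => Subtype.ext
        (LinearMap.congr_fun (congrArg Subtype.val hfg) x)
  have h1 := natLength_ker_add_range (F.homDiff X j)
  rw [natLength_linearMap_pi] at h1
  have h2 := natLength_submodule_add_quotient _ _ (F.range_homDiff_le_ker X j)
  have h3 := hT j
  have h4 := hT (j + 1)
  change _ ≤ _ + natLength R (_ ⧸ _)
  rw [add_mul]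
  lia

theorem natLength_dualKer_le (F : MinimalFreeResolution R M) (m : ℕ) :
    natLength R (F.dualKer m) ≤ F.betti m * natLength R R := by
  rw [← natLength_dualTerm]
  exact natLength_le_of_injective _ (Submodule.subtype_injective _)

theorem natLength_dualKer_add {F : MinimalFreeResolution R M} {m : ℕ}
    (h : F.HomExactAtSucc R m) :
    natLength R (F.dualKer m) + natLength R (F.dualKer (m + 1)) =
      F.betti m * natLength R R := by
  have h1 := natLength_ker_add_range (F.toDualKer m)
  rw [ker_toDualKer, natLength_dualTerm] at h1
  rw [h1, (LinearEquiv.ofTop _ (LinearMap.range_eq_top.mpr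
    (toDualKer_surjective h))).natLength_eq]

/-- The socle of `Hom(F_m, R)` is contained in `C_m`. -/
theorem betti_mul_socleDim_le (F : MinimalFreeResolution R M) (m : ℕ) :
    F.betti m * socleDim R ≤ natLength R
      (Submodule.torsionBySet R (F.dualKer m) (IsLocalRing.maximalIdeal R)) := by
  have hz : ∀ (f : (Fin (F.betti m) → R) →ₗ[R]
      Submodule.torsionBySet R R (IsLocalRing.maximalIdeal R)),
      ∀ r ∈ IsLocalRing.maximalIdeal R, ∀ x, r • (f x).1 = 0 := fun f r hr x =>
    (Submodule.mem_torsionBySet_iff _ _).mp (f x).2 ⟨r, hr⟩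
  let ι : ((Fin (F.betti m) → R) →ₗ[R] Submodule.torsionBySet R R (IsLocalRing.maximalIdeal R))
      →ₗ[R] F.DualTerm m := LinearMap.compRight R (Submodule.subtype _)
  have hι : ∀ f, ι f ∈ F.dualKer m := fun f =>
    F.comp_d_eq_zero_of_forall_smul_eq_zero m (Submodule.subtype _ ∘ₗ f) (hz f)
  rw [socleDim, ← natLength_linearMap_pi]
  refine natLength_le_of_injective ((ι.codRestrict _ hι).codRestrict _
      fun f => (Submodule.mem_torsionBySet_iff _ _).mpr fun r => Subtype.ext
        (LinearMap.ext fun x => hz f r.1 r.2 x)) fun f g hfg => ?_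
  exact LinearMap.ext fun x => Subtype.ext
    (LinearMap.congr_fun (congrArg (fun t => t.1.1) hfg : ι f = ι g) x)

variable {N : Type u} [AddCommGroup N] [Module R N]

/-- `Ext^{j+1}(N, C_m)` depends only on `j + m`, so it can be bounded by taking `j` minimal. -/
theorem natLength_homCohomology_dualKer_le (F : MinimalFreeResolution R M)
    (G : MinimalFreeResolution R N) {m₀ j₀ : ℕ} (hF : ∀ m, m₀ ≤ m → F.HomExactAtSucc R m)
    (hG : ∀ j, j₀ ≤ j → G.HomExactAtSucc R j) (k : ℕ) : ∀ m, m₀ ≤ m →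
      natLength R (G.HomCohomology (F.dualKer m) (j₀ + k)) ≤
        G.betti (j₀ + 1) * (F.betti (m + k) * natLength R R) := by
  induction k with
  | zero =>
    intro m _
    exact (G.natLength_homCohomology_le _ _).trans
      (Nat.mul_le_mul_left _ (F.natLength_dualKer_le m))
  | succ k ih =>
    intro m hm
    have h := G.natLength_homCohomology_ker_le (F.toDualKer m) (toDualKer_surjective (hF m hm))
      (j₀ + k) ((hG _ (by lia)).dual _)
    rw [ker_toDualKer] at h
    have := ih (m + 1) (by lia)
    rw [show m + 1 + k = m + (k + 1) by lia] at this
    exact h.trans this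

/-- The bound on `Ext^{j₀+k+1}(N, C_m)` bounds the socle of `C_m`. For `k → ∞` the last summand is
of smaller order than the others when the Betti numbers of `N` grow faster than those of `M`. -/
theorem betti_mul_betti_mul_socleDim_le (F : MinimalFreeResolution R M)
    (G : MinimalFreeResolution R N) {m₀ j₀ : ℕ} (hF : ∀ m, m₀ ≤ m → F.HomExactAtSucc R m)
    (hG : ∀ j, j₀ ≤ j → G.HomExactAtSucc R j) (k m : ℕ) (hm : m₀ ≤ m) :
    (G.betti (j₀ + k + 1) + G.betti (j₀ + k)) * (F.betti m * socleDim R) ≤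
      G.betti (j₀ + k) * natLength R (F.dualKer m) +
        G.betti (j₀ + 1) * (F.betti (m + k) * natLength R R) :=
  (Nat.mul_le_mul_left _ (F.betti_mul_socleDim_le m)).trans
    ((G.betti_mul_natLength_torsion_le _ _).trans
      (Nat.add_le_add_left (F.natLength_homCohomology_dualKer_le G hF hG k m hm) _))

end MinimalFreeResolution

/-! ### The Hilbert function and the socle of a local ring with `𝔪⁴ = 0` -/

/-- Induction on the length of `A`; for a simple module `A`, evaluation at a generator is
injective. -/
theorem Module.length_linearMap_le {R : Type*} [CommRing R] {A T : Type*} [AddCommGroup A]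
    [Module R A] [AddCommGroup T] [Module R T] (hA : IsFiniteLength R A) :
    Module.length R (A →ₗ[R] T) ≤ Module.length R A * Module.length R T := by
  induction hA with
  | of_subsingleton => simp [Module.length_eq_zero]
  | @of_simple_quotient A _ _ N hS _ ih =>
    have hS' : Module.length R ((A ⧸ N) →ₗ[R] T) ≤ Module.length R T := by
      have := IsSimpleModule.nontrivial R (A ⧸ N)
      obtain ⟨x, hx⟩ := exists_ne (0 : A ⧸ N)
      refine Module.length_le_of_injective (LinearMap.applyₗ x) fun f g hfg => ?_
      refine LinearMap.ext_on (s := {x}) ?_ (by simpa using hfg)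
      exact IsSimpleModule.span_singleton_eq_top R hx
    have h1 := Module.length_eq_add_of_exact N.subtype N.mkQ N.subtype_injective
      N.mkQ_surjective (LinearMap.exact_subtype_mkQ N)
    have h2 := Module.length_eq_add_of_exact
      (LinearMap.ker (LinearMap.lcomp R T N.subtype)).subtype
      (LinearMap.lcomp R T N.subtype).rangeRestrict (Submodule.subtype_injective _)
      (LinearMap.surjective_rangeRestrict _) fun x => by simp [← LinearMap.mem_ker]
    have h3 : Module.length R (LinearMap.ker (LinearMap.lcomp R T N.subtype)) ≤
        Module.length R ((A ⧸ N) →ₗ[R] T) := by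
      refine Module.length_le_of_surjective ((LinearMap.lcomp R T N.mkQ).codRestrict _
        fun f => LinearMap.ext fun x => ?_) fun f => ?_
      · exact (congrArg f ((Submodule.Quotient.mk_eq_zero N).mpr x.2)).trans (map_zero f)
      · refine ⟨N.liftQ f.1 fun x hx => LinearMap.congr_fun (LinearMap.mem_ker.mp f.2) ⟨x, hx⟩,
          Subtype.ext (LinearMap.ext fun x => rfl)⟩
    have h4 := Module.length_le_of_injective
      (LinearMap.range (LinearMap.lcomp R T N.subtype)).subtype (Submodule.subtype_injective _)
    rw [h2, h1, Module.length_eq_one R (A ⧸ N), add_mul, one_mul, add_comm]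
    exact add_le_add (h4.trans ih) (h3.trans hS')

section Ring

open IsLocalRing

theorem pow_three_le_socle {R : Type*} [CommRing R] [IsLocalRing R]
    (hm4 : maximalIdeal R ^ 4 = ⊥) :
    maximalIdeal R ^ 3 ≤ Submodule.torsionBySet R R (maximalIdeal R) := by
  intro x hx
  refine (Submodule.mem_torsionBySet_iff _ _).mpr fun r => ?_
  have : (r : R) * x ∈ maximalIdeal R ^ 4 := by
    rw [pow_succ']
    exact Ideal.mul_mem_mul r.2 hx
  simpa [hm4] using this

variable (R : Type*) [CommRing R] [IsLocalRing R] [IsNoetherianRing R] [IsArtinianRing R]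

theorem hilbertFun_zero : hilbertFun R 0 = 1 := by
  have h1 := natLength_pow_maximalIdeal R 0
  have h2 := natLength_eq_add_of_exact (R := R) (maximalIdeal R).subtype (maximalIdeal R).mkQ
    (Submodule.subtype_injective _) (Submodule.mkQ_surjective _) (LinearMap.exact_subtype_mkQ _)
  have h3 : natLength R (R ⧸ maximalIdeal R) = 1 := by
    have : IsSimpleModule R (R ⧸ maximalIdeal R) :=
      (isSimpleModule_iff_quot_maximal (R := R)).mpr
        ⟨_, maximalIdeal.isMaximal R, ⟨LinearEquiv.refl _ _⟩⟩
    simp [natLength, Module.length_eq_one]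
  have h4 : natLength R ↥(maximalIdeal R ^ 0) = natLength R R := by
    rw [pow_zero, Ideal.one_eq_top]
    exact Submodule.topEquiv.natLength_eq
  rw [zero_add, pow_one] at h1
  lia

variable {R}

theorem natLength_pow_three_maximalIdeal (hm4 : maximalIdeal R ^ 4 = ⊥) :
    natLength R ↥(maximalIdeal R ^ 3) = hilbertFun R 3 := by
  have h := natLength_pow_maximalIdeal R 3
  have h0 : natLength R ↥(maximalIdeal R ^ (3 + 1)) = 0 := by
    rw [hm4]
    exact natLength_eq_zero
  lia

theorem natLength_self_eq (hm4 : maximalIdeal R ^ 4 = ⊥) :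
    natLength R R = 1 + hilbertFun R 1 + hilbertFun R 2 + hilbertFun R 3 := by
  have h0 := natLength_pow_maximalIdeal R 0
  have h1 := natLength_pow_maximalIdeal R 1
  have h2 := natLength_pow_maximalIdeal R 2
  have h3 := natLength_pow_three_maximalIdeal hm4
  have h4 : natLength R ↥(maximalIdeal R ^ 0) = natLength R R := by
    rw [pow_zero, Ideal.one_eq_top]
    exact Submodule.topEquiv.natLength_eq
  have h5 := hilbertFun_zero R
  lia

theorem hilbertFun_three_pos (hm4 : maximalIdeal R ^ 4 = ⊥) (hm3 : maximalIdeal R ^ 3 ≠ ⊥) :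
    0 < hilbertFun R 3 := by
  rw [← natLength_pow_three_maximalIdeal hm4]
  have := Submodule.nontrivial_iff_ne_bot.mpr hm3
  exact natLength_pos

theorem hilbertFun_three_le_socleDim (hm4 : maximalIdeal R ^ 4 = ⊥) :
    hilbertFun R 3 ≤ socleDim R := by
  rw [← natLength_pow_three_maximalIdeal hm4]
  exact natLength_le_of_injective _ (Submodule.inclusion_injective (pow_three_le_socle hm4))

/-- If the socle is `𝔪³`, then multiplication embeds `𝔪²/𝔪³` into `Hom(𝔪/𝔪², 𝔪³)`. -/
theorem hilbertFun_two_le (hm4 : maximalIdeal R ^ 4 = ⊥) (h : socleDim R = hilbertFun R 3) :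
    hilbertFun R 2 ≤ hilbertFun R 1 * hilbertFun R 3 := by
  have hsoc : ∀ z : R, (∀ x ∈ maximalIdeal R, x * z = 0) → z ∈ maximalIdeal R ^ 3 := by
    intro z hz
    by_contra hz3
    have hlt : Submodule.submoduleOf (maximalIdeal R ^ 3)
        (Submodule.torsionBySet R R (maximalIdeal R)) ≠ ⊤ := by
      intro htop
      have : (⟨z, (Submodule.mem_torsionBySet_iff _ _).mpr fun r => hz r.1 r.2⟩ :
          Submodule.torsionBySet R R (maximalIdeal R)) ∈ Submodule.submoduleOf
          (maximalIdeal R ^ 3) (Submodule.torsionBySet R R (maximalIdeal R)) := by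
        rw [htop]; trivial
      exact hz3 this
    have h1 := natLength_submodule_add_quotient _ _ (pow_three_le_socle hm4)
    rw [natLength_pow_three_maximalIdeal hm4, ← h] at h1
    change natLength R (Submodule.torsionBySet R R (maximalIdeal R)) =
      natLength R (Submodule.torsionBySet R R (maximalIdeal R)) + _ at h1
    have h2 : natLength R (_ ⧸ Submodule.submoduleOf (maximalIdeal R ^ 3)
        (Submodule.torsionBySet R R (maximalIdeal R))) ≠ 0 := by
      have := Submodule.Quotient.nontrivial_iff.mpr hlt
      exact natLength_pos.ne'
    lia
  let μ : ↥(maximalIdeal R ^ 1) →ₗ[R] ↥(maximalIdeal R ^ 2) →ₗ[R] ↥(maximalIdeal R ^ 3) :=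
    LinearMap.mk₂ R (fun x z => ⟨x.1 * z.1, by
        rw [show 3 = 1 + 2 from rfl, pow_add]
        exact Ideal.mul_mem_mul x.2 z.2⟩)
      (fun _ _ _ => Subtype.ext (add_mul _ _ _)) (fun _ _ _ => Subtype.ext (mul_assoc _ _ _))
      (fun _ _ _ => Subtype.ext (mul_add _ _ _))
      (fun _ _ _ => Subtype.ext (mul_left_comm _ _ _))
  have hμ : (maximalIdeal R ^ (1 + 1)).submoduleOf (maximalIdeal R ^ 1) ≤ LinearMap.ker μ := by
    intro x hx
    refine LinearMap.ext fun z => Subtype.ext ?_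
    have : x.1 * z.1 ∈ maximalIdeal R ^ 4 := by
      rw [show 4 = 1 + 1 + 2 from rfl, pow_add _ (1 + 1)]
      exact Ideal.mul_mem_mul hx z.2
    rw [hm4] at this
    exact this
  have key := natLength_le_of_ker_le (LinearMap.flip (Submodule.liftQ _ μ hμ))
    ((maximalIdeal R ^ (2 + 1)).submoduleOf (maximalIdeal R ^ 2)).mkQ
    (Submodule.mkQ_surjective _) fun z hz => by
      rw [Submodule.ker_mkQ]
      refine hsoc z.1 fun x hx => ?_
      exact congrArg Subtype.val (LinearMap.congr_fun (LinearMap.mem_ker.mp hz)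
        (Submodule.Quotient.mk ⟨x, by rwa [pow_one]⟩))
  refine key.trans ?_
  have hle := Module.length_linearMap_le (R := R)
    (A := ↥(maximalIdeal R ^ 1) ⧸ (maximalIdeal R ^ (1 + 1)).submoduleOf (maximalIdeal R ^ 1))
    (T := ↥(maximalIdeal R ^ 3)) (Module.length_ne_top_iff.mp Module.length_ne_top)
  have := ENat.toNat_le_toNat hle (WithTop.mul_ne_top Module.length_ne_top Module.length_ne_top)
  rw [ENat.toNat_mul] at this
  rw [← natLength_pow_three_maximalIdeal hm4]
  exact this

end Ring

/-! ### Exponential growth of Betti numbers -/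

theorem HasExponentialGrowth.exists_tendsto {s : ℕ → ℕ} {a : ℝ} (h : HasExponentialGrowth s a) :
    ∃ β : ℝ, 0 < β ∧ Tendsto (fun i => (s i : ℝ) / a ^ i) atTop (𝓝 β) := by
  obtain ⟨ha, β, hβ, ρ, hρ, hs⟩ := h
  refine ⟨β, hβ, tendsto_of_tendsto_of_tendsto_of_le_of_le' (g := fun i => β - ρ i / a ^ i)
    (h := fun i => β + ρ i / a ^ i) ?_ ?_ ?_ ?_⟩
  · simpa using hρ.const_sub β
  · simpa using hρ.const_add β
  · filter_upwards [hs] with i hi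
    have : 0 < a ^ i := by positivity
    rw [le_div_iff₀ this, sub_mul, div_mul_cancel₀ _ this.ne']
    exact hi.1
  · filter_upwards [hs] with i hi
    have : 0 < a ^ i := by positivity
    rw [div_le_iff₀ this, add_mul, div_mul_cancel₀ _ this.ne']
    exact hi.2

/-- The base of the growth of a solution of a linear recurrence is a characteristic root. -/
theorem HasExponentialGrowth.isRoot {s : ℕ → ℕ} {a : ℝ} (h : HasExponentialGrowth s a)
    {e₁ e₂ e₃ n : ℕ}
    (hrec : ∀ i, n ≤ i → s (i + 3) + s (i + 1) * e₂ = s (i + 2) * e₁ + s i * e₃) :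
    a ^ 3 + e₂ * a = e₁ * a ^ 2 + e₃ := by
  obtain ⟨β, hβ, hlim⟩ := h.exists_tendsto
  have ha : 0 < a := zero_lt_one.trans h.1
  have hl : ∀ c, Tendsto (fun i => (s (i + c) : ℝ) / a ^ i) atTop (𝓝 (a ^ c * β)) := by
    intro c
    refine (((tendsto_add_atTop_iff_nat c).mpr hlim).const_mul (a ^ c)).congr fun i => ?_
    rw [pow_add]
    field_simp
  have h1 := (hl 3).add ((hl 1).mul_const (e₂ : ℝ))
  have h2 := ((hl 2).mul_const (e₁ : ℝ)).add ((hl 0).mul_const (e₃ : ℝ))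
  have h3 : a ^ 3 * β + a ^ 1 * β * e₂ = a ^ 2 * β * e₁ + a ^ 0 * β * e₃ := by
    refine tendsto_nhds_unique_of_eventuallyEq h1 h2 ?_
    filter_upwards [eventually_ge_atTop n] with i hi
    have := hrec i hi
    simp only [div_mul_eq_mul_div, ← add_div, add_zero]
    congr 1
    exact_mod_cast this
  apply mul_left_cancel₀ hβ.ne'
  linear_combination h3

namespace MinimalFreeResolution

variable {R : Type u} [CommRing R] [IsLocalRing R] [IsNoetherianRing R] [IsArtinianRing R]
  {M N : Type u} [AddCommGroup M] [Module R M] [AddCommGroup N] [Module R N]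

/-- If `Ext^i(M, R)` and `Ext^i(N, R)` vanish for large `i`, and the Betti numbers of `M` and `N`
grow with bases `a < b`, then `(1 + a) (1 + b) dim (soc R) ≤ length R`. -/
theorem mul_socleDim_le_natLength (F : MinimalFreeResolution R M) (G : MinimalFreeResolution R N)
    (hM : ExtEventuallyVanishes R M) (hN : ExtEventuallyVanishes R N) {a b : ℝ}
    (ha : HasExponentialGrowth F.betti a) (hb : HasExponentialGrowth G.betti b) (hab : a < b) :
    (1 + a) * (1 + b) * socleDim R ≤ natLength R R := by
  obtain ⟨m₀, hF⟩ := F.eventually_homExactAtSucc hM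
  obtain ⟨j₀, hG⟩ := G.eventually_homExactAtSucc hN
  obtain ⟨β, hβ, hlimF⟩ := ha.exists_tendsto
  obtain ⟨γ, hγ, hlimG⟩ := hb.exists_tendsto
  have ha0 : 0 < a := zero_lt_one.trans ha.1
  have hb0 : 0 < b := zero_lt_one.trans hb.1
  -- let `k → ∞` in the inequality for `Ext^{j₀ + k + 1}(N, C_m)`
  have key : ∀ m, m₀ ≤ m →
      (b + 1) * (F.betti m * socleDim R) ≤ (natLength R (F.dualKer m) : ℝ) := by
    intro m hm
    have hl : ∀ c, Tendsto (fun k => (G.betti (j₀ + k + c) : ℝ) / b ^ k) atTop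
        (𝓝 (b ^ (j₀ + c) * γ)) := by
      intro c
      refine (((tendsto_add_atTop_iff_nat (j₀ + c)).mpr hlimG).const_mul
        (b ^ (j₀ + c))).congr fun k => ?_
      rw [show k + (j₀ + c) = j₀ + k + c by lia, show j₀ + k + c = k + (j₀ + c) by lia,
        pow_add b k]
      field_simp
    have hl0 : Tendsto (fun k => (F.betti (m + k) : ℝ) / b ^ k) atTop (𝓝 0) := by
      have h1 := (((tendsto_add_atTop_iff_nat m).mpr hlimF).const_mul (a ^ m)).mul
        (tendsto_pow_atTop_nhds_zero_of_lt_one (r := a / b) (by positivity)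
          ((div_lt_one hb0).mpr hab))
      rw [mul_zero] at h1
      refine h1.congr fun k => ?_
      rw [add_comm k m, pow_add, div_pow]
      field_simp
    have h1 := ((hl 1).add (hl 0)).mul_const ((F.betti m * socleDim R : ℕ) : ℝ)
    have h2 := ((hl 0).mul_const (natLength R (F.dualKer m) : ℝ)).add
      ((hl0.mul_const (natLength R R : ℝ)).const_mul (G.betti (j₀ + 1) : ℝ))
    have h3 := le_of_tendsto_of_tendsto' h1 h2 fun k => by
      have hk := F.betti_mul_betti_mul_socleDim_le G hF hG k m hm
      have hk' : ((G.betti (j₀ + k + 1) : ℝ) + G.betti (j₀ + k)) *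
          ((F.betti m * socleDim R : ℕ) : ℝ) ≤ G.betti (j₀ + k) * natLength R (F.dualKer m) +
            G.betti (j₀ + 1) * (F.betti (m + k) * natLength R R) := by exact_mod_cast hk
      have hbk : 0 < b ^ k := by positivity
      have := div_le_div_of_nonneg_right hk' hbk.le
      calc _ = _ := by rw [← add_div, div_mul_eq_mul_div]; rfl
        _ ≤ _ := this
        _ = _ := by rw [add_zero]; ring
    push_cast at h3
    rw [pow_succ, add_zero] at h3
    refine le_of_mul_le_mul_left ?_ (show 0 < b ^ j₀ * γ by positivity)
    linarith
  -- add the inequalities for `C_m` and `C_{m+1}` and let `m → ∞`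
  have hl : Tendsto (fun m => (F.betti (m + 1) : ℝ) / a ^ m) atTop (𝓝 (a * β)) := by
    refine (((tendsto_add_atTop_iff_nat 1).mpr hlimF).const_mul a).congr fun m => ?_
    rw [pow_succ]
    field_simp
  have h1 := ((hlimF.add hl).mul_const (socleDim R : ℝ)).const_mul (b + 1)
  have h2 := hlimF.mul_const (natLength R R : ℝ)
  have h3 := le_of_tendsto_of_tendsto h1 h2 (by
    filter_upwards [eventually_ge_atTop m₀] with m hm
    have hadd : (natLength R (F.dualKer m) : ℝ) + natLength R (F.dualKer (m + 1)) =
        F.betti m * natLength R R := by exact_mod_cast natLength_dualKer_add (hF m hm)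
    have ham : 0 < a ^ m := by positivity
    rw [← add_div, div_mul_eq_mul_div, div_mul_eq_mul_div, ← mul_div_assoc]
    refine div_le_div_of_nonneg_right ?_ ham.le
    linarith [key m hm, key (m + 1) (by lia)])
  refine le_of_mul_le_mul_left ?_ hβ
  linarith

end MinimalFreeResolution

/-! ### Roots of the characteristic polynomial -/

/-- Two characteristic roots `1 < a < b` of `t³ - e₁ t² + e₂ t - e₃` are incompatible with the
bound on the dimension `s` of the socle.  With `c` the third root, `1 + e₁ + e₂ + e₃` factors as
`(1 + a) (1 + b) (1 + c)`, so that `a b c = e₃ ≤ s ≤ 1 + c`. -/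
theorem not_lt_of_characteristic_roots {a b : ℝ} {e₁ e₂ e₃ s : ℕ} (ha : 1 < a)
    (hra : a ^ 3 + e₂ * a = e₁ * a ^ 2 + e₃) (hrb : b ^ 3 + e₂ * b = e₁ * b ^ 2 + e₃)
    (he₃ : 0 < e₃) (hs : e₃ ≤ s) (hs' : s = e₃ → e₂ ≤ e₁ * e₃)
    (hle : (1 + a) * (1 + b) * s ≤ 1 + e₁ + e₂ + e₃) : ¬ a < b := by
  intro hab
  have hb : 1 < b := ha.trans hab
  obtain ⟨c, hc⟩ : ∃ c : ℝ, c = e₁ - a - b := ⟨_, rfl⟩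
  have h1 : (e₁ : ℝ) = a + b + c := by rw [hc]; ring
  have h2 : (e₂ : ℝ) = a * b + c * (a + b) := by
    apply mul_left_cancel₀ (sub_ne_zero.mpr hab.ne)
    linear_combination hra - hrb + (a ^ 2 - b ^ 2) * h1
  have h3 : (e₃ : ℝ) = a * b * c := by
    linear_combination - hra - a ^ 2 * h1 + a * h2
  have hs1 : (s : ℝ) ≤ 1 + c := by
    refine le_of_mul_le_mul_left ?_ (show 0 < (1 + a) * (1 + b) by positivity)
    rw [h1, h2, h3] at hle
    linarith
  have hse : (e₃ : ℝ) ≤ s := by exact_mod_cast hs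
  have he1 : (1 : ℝ) ≤ e₃ := by exact_mod_cast he₃
  have hab1 : 1 < a * b := one_lt_mul_of_lt_of_le ha hb.le
  have hab0 : 0 < (a - 1) * (b - 1) := mul_pos (by linarith) (by linarith)
  have hc0 : 0 < c := by
    by_contra hc0
    nlinarith
  -- the value of the characteristic polynomial at `1` is an integer
  have hval : (e₁ : ℝ) + e₃ - 1 - e₂ = (a - 1) * (b - 1) * (c - 1) := by
    rw [h1, h2, h3]; ring
  rcases Nat.lt_or_ge e₃ 2 with he | he
  · have he : e₃ = 1 := by lia
    subst he
    have hc1 : c < 1 := by push_cast at h3; nlinarith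
    have hs2 : s = 1 := by
      have : (s : ℝ) < 2 := by linarith
      have : s < 2 := by exact_mod_cast this
      lia
    have h21 : (e₂ : ℝ) ≤ e₁ := by exact_mod_cast (by simpa using hs' hs2 : e₂ ≤ e₁)
    push_cast at hval
    nlinarith [mul_pos hab0 (show 0 < 1 - c by linarith)]
  · have he2 : (2 : ℝ) ≤ e₃ := by exact_mod_cast he
    have hc1 : 1 ≤ c := by linarith
    have hsmall : (a - 1) * (b - 1) * (c - 1) < 1 := by
      have h4 : (a - 1) * (b - 1) * c < 1 := by nlinarith
      linarith
    have hint : e₁ + e₃ = 1 + e₂ := by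
      have hlo : (1 + e₂ : ℝ) ≤ e₁ + e₃ := by
        linarith [mul_nonneg hab0.le (show 0 ≤ c - 1 by linarith)]
      have hhi : (e₁ + e₃ : ℝ) < 1 + e₂ + 1 := by linarith
      have hlo' : 1 + e₂ ≤ e₁ + e₃ := by exact_mod_cast hlo
      have hhi' : e₁ + e₃ < 1 + e₂ + 1 := by exact_mod_cast hhi
      lia
    have hc1 : c = 1 := by
      have hint' : (e₁ + e₃ : ℝ) = 1 + e₂ := by exact_mod_cast hint
      have : (a - 1) * (b - 1) * (c - 1) = 0 := by linarith
      have := (mul_eq_zero.mp this).resolve_left hab0.ne'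
      linarith
    -- now `a b = 2`, and `a + b` is an integer strictly between `2` and `3`
    rw [hc1] at h1 h2 h3 hs1
    have hab2 : a * b = 2 := by linarith
    have hlo : (3 : ℝ) < e₁ := by linarith
    have hhi : (e₁ : ℝ) < 4 := by nlinarith
    have hlo' : 3 < e₁ := by exact_mod_cast hlo
    have hhi' : e₁ < 4 := by exact_mod_cast hhi
    lia

/-! ### Comparison of the bases -/

namespace MinimalFreeResolution

theorem not_lt_of_hasExponentialGrowth {R : Type u} [CommRing R] [IsLocalRing R]
    [IsNoetherianRing R] (hm4 : IsLocalRing.maximalIdeal R ^ 4 = ⊥)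
    (hm3 : IsLocalRing.maximalIdeal R ^ 3 ≠ ⊥) {M N : Type u} [AddCommGroup M] [Module R M]
    [AddCommGroup N] [Module R N] (F : MinimalFreeResolution R M) (G : MinimalFreeResolution R N)
    (hF : F.IsEventuallyLinear) (hG : G.IsEventuallyLinear)
    (hM : ExtEventuallyVanishes R M) (hN : ExtEventuallyVanishes R N)
    {a b : ℝ} (ha : HasExponentialGrowth F.betti a) (hb : HasExponentialGrowth G.betti b) :
    ¬ a < b := by
  intro hab
  have : IsArtinianRing R := (isArtinianRing_iff_isNilpotent_maximalIdeal R).mpr ⟨4, hm4⟩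
  obtain ⟨m, hm⟩ := F.eventually_betti_recurrence hm4 hF
  obtain ⟨n, hn⟩ := G.eventually_betti_recurrence hm4 hG
  simp only [hilbertFun_zero, mul_one] at hm hn
  have hle := F.mul_socleDim_le_natLength G hM hN ha hb hab
  rw [natLength_self_eq hm4] at hle
  push_cast at hle
  exact not_lt_of_characteristic_roots ha.1 (ha.isRoot hm) (hb.isRoot hn)
    (hilbertFun_three_pos hm4 hm3) (hilbertFun_three_le_socleDim hm4) (hilbertFun_two_le hm4)
    hle hab

end MinimalFreeResolution

theorem mainTheorem4 {R : Type u} [CommRing R] [IsLocalRing R] [IsNoetherianRing R]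
    (hm4 : IsLocalRing.maximalIdeal R ^ 4 = ⊥) (hm3 : IsLocalRing.maximalIdeal R ^ 3 ≠ ⊥)
    {M N : Type u} [AddCommGroup M] [Module R M] [Module.Finite R M]
    [AddCommGroup N] [Module R N] [Module.Finite R N]
    (F : MinimalFreeResolution R M) (G : MinimalFreeResolution R N)
    (hF : F.IsEventuallyLinear) (hG : G.IsEventuallyLinear)
    (hM : ExtEventuallyVanishes R M) (hN : ExtEventuallyVanishes R N)
    {a b : ℝ} (ha : HasExponentialGrowth F.betti a) (hb : HasExponentialGrowth G.betti b) :
    a = b := by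
  exact le_antisymm
    (not_lt.mp (G.not_lt_of_hasExponentialGrowth hm4 hm3 F hG hF hN hM hb ha))
    (not_lt.mp (F.not_lt_of_hasExponentialGrowth hm4 hm3 G hF hG hM hN ha hb))
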